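/- Let $k$ be a number field, let $\overline{k}$ be an algebraic closure of $k$, and let $e>1$ be an integer. For real $T$ let $N_{\Delta}(T)$ be the number of fields $K$ with $k\subseteq K\subseteq\overline{k}$, $[K:k]=e$ and $|\Delta_K|\le T$, where $\Delta_K$ denotes the (absolute) discriminant of the number field $K$ over $\mathbb{Q}$. Then there are positive constants $c$ and $T_1$, depending only on $k$ and $e$, such that $$N_{\Delta}(T)\ \ge\ c\,T^{1/2}\qquad\text{for all real } T\ge T_1 .$$ -/

import Mathlib

namespace NumberFieldCount

/-- `𝒞_e(k)`: the extensions `K` of `k` of degree `e` inside the algebraic closure `Ω` of `k`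
(distinct subfields are counted separately, even when they are isomorphic over `k`).
For `e = 0` Mathlib's `finrank` convention would give the infinite extensions;
only `e > 1` is used. -/
def extensionsOfDegree (k : Type*) [Field k] (Ω : Type*) [Field Ω] [Algebra k Ω] (e : ℕ) :
    Set (IntermediateField k Ω) :=
  {K | Module.finrank k K = e}

/-- Extensions of positive finite degree of a number field are number fields, so that the
existential in `extensionsOfDegreeDiscrLE` removes no field. -/
theorem numberField_of_mem {k : Type*} [Field k] [NumberField k] {Ω : Type*} [Field Ω]
    [Algebra k Ω] {e : ℕ} (he : 0 < e) {K : IntermediateField k Ω}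
    (hK : K ∈ extensionsOfDegree k Ω e) : NumberField K := by
  have h : Module.finrank k K = e := hK
  have : FiniteDimensional k K := Module.finite_of_finrank_pos (by omega)
  exact NumberField.of_module_finite k K

/-- The members `K` of `𝒞_e(k)` whose absolute discriminant `Δ_K` (over `ℚ`) satisfies
`|Δ_K| ≤ T`. -/
def extensionsOfDegreeDiscrLE (k : Type*) [Field k] (Ω : Type*) [Field Ω] [Algebra k Ω]
    (e : ℕ) (T : ℝ) : Set (IntermediateField k Ω) :=
  {K | K ∈ extensionsOfDegree k Ω e ∧ ∃ _ : NumberField K, ((|NumberField.discr K| : ℤ) : ℝ) ≤ T}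

/-- `N_Δ(T)`, the number of extensions `K/k` of degree `e` in `Ω` with `|Δ_K| ≤ T`. -/
noncomputable def discrCount (k : Type*) [Field k] (Ω : Type*) [Field Ω] [Algebra k Ω]
    (e : ℕ) (T : ℝ) : ℕ :=
  (extensionsOfDegreeDiscrLE k Ω e T).ncard

end NumberFieldCount

/-! Let m = [k : ℚ] and let E be m times the sum of j over j < e. Consider monic Eisenstein
polynomials over `𝓞 k` whose coefficient of degree j has conjugates of size O(N^(e-j)). There are at
least N^(E + m*e) of them, and a root α of each generates a field of degree e. By
`norm_le_two_mul_of_root` the conjugates of α are O(N), so the basis ω_i α^j gives |Δ| = O(N^(2E))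
(`abs_discr_le_of_powerBasis`). A field of degree m*e over ℚ contains only O(N^(m*e)) integers with
all conjugates O(N) (`card_le_of_forall_norm_embedding_le`), so each field arises that often at
most. Hence at least a constant times N^E fields occur, which is of order T^(1/2) for T of order
N^(2E). -/

namespace NumberFieldCount

open NumberField Polynomial IntermediateField

/-! ### Sizes of algebraic integers and of roots -/

/-- The number of algebraic integers of `K` all of whose conjugates are at most `X` in absolute value
is `O(X ^ [K : ℚ])`, with a constant depending only on the degree. -/
theorem card_le_of_forall_norm_embedding_le {K : Type*} [Field K] [NumberField K]
    (X : ℝ) (s : Finset K) (hint : ∀ α ∈ s, IsIntegral ℤ α)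
    (hs : ∀ α ∈ s, ∀ φ : K →+* ℂ, ‖φ α‖ ≤ X) (M : ℕ) (hM : 8 * X + 2 ≤ M) :
    s.card ≤ M ^ Module.finrank ℚ K := by
  classical
  -- One real number per embedding keeps the exponent at [K : ℚ]. Nothing is lost: φ and its
  -- conjugate give re + im and re - im, whose squares sum to 2‖φ α‖².
  let r : K → (K →+* ℂ) → ℝ := fun α φ ↦ (φ α).re + (φ α).im
  let F : K → (K →+* ℂ) → ℤ := fun α φ ↦ ⌊2 * r α φ⌋
  have hinj : Set.InjOn F s := by
    intro α hα β hβ h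
    have hr : ∀ φ, |r (α - β) φ| < 1 / 2 := by
      intro φ
      have h1 : |2 * r α φ - 2 * r β φ| < 1 := Int.abs_sub_lt_one_of_floor_eq_floor (congrFun h φ)
      have h2 : r (α - β) φ = r α φ - r β φ := by
        simp only [r, map_sub, Complex.sub_re, Complex.sub_im]; ring
      rw [h2]
      rw [abs_lt] at h1 ⊢
      constructor <;> linarith [h1.1, h1.2]
    have hlt : ∀ φ : K →+* ℂ, ‖φ (α - β)‖ < 1 := by
      intro φ
      have h1 := abs_lt.mp (hr φ)
      have h2 := abs_lt.mp (hr (ComplexEmbedding.conjugate φ))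
      simp only [r, ComplexEmbedding.conjugate_coe_eq, Complex.conj_re, Complex.conj_im] at h1 h2
      rw [← sq_lt_one_iff₀ (norm_nonneg _), Complex.sq_norm, Complex.normSq_apply]
      nlinarith [h1.1, h1.2, h2.1, h2.2]
    by_contra hne
    have hne : α - β ≠ 0 := sub_ne_zero.mpr hne
    have hI : IsIntegral ℤ (α - β) := (hint α hα).sub (hint β hβ)
    -- A nonzero algebraic integer has norm at least 1 in absolute value, so its conjugates cannot
    -- all be smaller than 1.
    obtain ⟨n, hn⟩ := IsIntegrallyClosed.isIntegral_iff.mp (Algebra.isIntegral_norm ℚ hI)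
    have h0 : n ≠ 0 := by
      rintro rfl
      exact hne (Algebra.norm_eq_zero_iff.mp (by rw [← hn, map_zero]))
    have hprod := Algebra.norm_eq_prod_embeddings ℚ ℂ (α - β)
    have h1 : (1 : ℝ) ≤ ‖algebraMap ℚ ℂ (Algebra.norm ℚ (α - β))‖ := by
      rw [← hn]
      simp only [eq_intCast, map_intCast, Complex.norm_intCast]
      exact_mod_cast Int.one_le_abs h0
    rw [hprod, norm_prod] at h1
    refine absurd h1 (not_le.mpr ?_)
    have : Nonempty (K →ₐ[ℚ] ℂ) := ⟨RingHom.equivRatAlgHom K ℂ (Classical.arbitrary _)⟩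
    calc ∏ σ : K →ₐ[ℚ] ℂ, ‖σ (α - β)‖ < ∏ σ : K →ₐ[ℚ] ℂ, 1 := by
          refine Finset.prod_lt_prod_of_nonempty (fun σ _ ↦ ?_) (fun σ _ ↦ hlt σ.toRingHom)
            Finset.univ_nonempty
          exact norm_pos_iff.mpr ((map_ne_zero σ).mpr hne)
      _ = 1 := by simp
  let B : Finset ((K →+* ℂ) → ℤ) :=
    Fintype.piFinset fun _ ↦ Finset.Ico ⌊-(4 * X)⌋ (⌊-(4 * X)⌋ + M)
  have hmap : Set.MapsTo F s B := by
    intro α hα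
    simp only [B, Finset.mem_coe, Fintype.mem_piFinset, Finset.mem_Ico, F]
    intro φ
    have h1 := (Complex.abs_re_le_norm (φ α)).trans (hs α hα φ)
    have h2 := (Complex.abs_im_le_norm (φ α)).trans (hs α hα φ)
    rw [abs_le] at h1 h2
    constructor
    · apply Int.floor_mono
      simp only [r]; linarith [h1.1, h2.1]
    · rw [Int.floor_lt]
      push_cast
      have := Int.lt_floor_add_one (-(4 * X))
      simp only [r]; linarith [h1.2, h2.2]
  have := Finset.card_le_card_of_injOn F hmap hinj
  simpa [B, Fintype.card_piFinset, Embeddings.card] using this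

/-- If ‖z‖ > 2X, the lower terms total at most (1 - 2^(-e)) ‖z‖^e by a geometric sum and cannot
cancel z^e. -/
theorem norm_le_two_mul_of_root {e : ℕ} {X : ℝ} (hX : 0 ≤ X) (a : Fin e → ℂ) (z : ℂ)
    (ha : ∀ j, ‖a j‖ ≤ X ^ (e - j : ℕ)) (hz : z ^ e + ∑ j : Fin e, a j * z ^ (j : ℕ) = 0) :
    ‖z‖ ≤ 2 * X := by
  by_contra! h
  have hz0 : 0 < ‖z‖ := by linarith
  have hX2 : X ≤ ‖z‖ / 2 := by linarith
  have h1 : ‖z‖ ^ e ≤ ∑ j : Fin e, (1 / 2) ^ (e - j : ℕ) * ‖z‖ ^ e := by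
    calc ‖z‖ ^ e = ‖∑ j : Fin e, a j * z ^ (j : ℕ)‖ := by
          rw [← norm_pow, eq_neg_of_add_eq_zero_left hz, norm_neg]
      _ ≤ ∑ j : Fin e, ‖a j‖ * ‖z‖ ^ (j : ℕ) := by
          refine (norm_sum_le _ _).trans (le_of_eq ?_)
          simp
      _ ≤ ∑ j : Fin e, (1 / 2) ^ (e - j : ℕ) * ‖z‖ ^ e := by
          refine Finset.sum_le_sum fun j _ ↦ ?_
          calc ‖a j‖ * ‖z‖ ^ (j : ℕ) ≤ (‖z‖ / 2) ^ (e - j : ℕ) * ‖z‖ ^ (j : ℕ) := by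
                gcongr
                exact (ha j).trans (pow_le_pow_left₀ hX hX2 _)
            _ = (1 / 2) ^ (e - j : ℕ) * (‖z‖ ^ (e - j : ℕ) * ‖z‖ ^ (j : ℕ)) := by
                rw [div_eq_mul_one_div, mul_pow]; ring
            _ = _ := by rw [← pow_add, Nat.sub_add_cancel j.2.le]
  have h2 : ∀ n : ℕ, ∑ j ∈ Finset.range n, (1 / 2 : ℝ) ^ (n - j) < 1 := by
    intro n
    have : ∑ j ∈ Finset.range n, (1 / 2 : ℝ) ^ (n - j) = 1 - (1 / 2) ^ n := by
      induction n with
      | zero => simp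
      | succ n ih =>
        rw [Finset.sum_range_succ]
        have : ∑ j ∈ Finset.range n, (1 / 2 : ℝ) ^ (n + 1 - j) =
            (1 / 2) * ∑ j ∈ Finset.range n, (1 / 2 : ℝ) ^ (n - j) := by
          rw [Finset.mul_sum]
          refine Finset.sum_congr rfl fun j hj ↦ ?_
          rw [Nat.succ_sub (Finset.mem_range.mp hj).le, pow_succ']
        rw [this, ih]
        simp only [Nat.add_sub_cancel_left, pow_succ]; ring
    rw [this]
    have : (0 : ℝ) < (1 / 2) ^ n := by positivity
    linarith
  rw [← Finset.sum_mul, Fin.sum_univ_eq_sum_range (fun j ↦ (1 / 2 : ℝ) ^ (e - j))] at h1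
  have := h2 e
  have : 0 < ‖z‖ ^ e := by positivity
  nlinarith

/-! ### Discriminant bounds and finiteness -/

theorem abs_det_le_factorial_mul_prod {n : Type*} [Fintype n] [DecidableEq n] (A : Matrix n n ℂ)
    (B : n → ℝ) (hA : ∀ i j, ‖A i j‖ ≤ B i) :
    ‖A.det‖ ≤ (Fintype.card n).factorial * ∏ i, B i := by
  rw [← Matrix.det_transpose, Matrix.det_apply]
  calc ‖∑ σ : Equiv.Perm n, Equiv.Perm.sign σ • ∏ i, A.transpose (σ i) i‖
      ≤ ∑ σ : Equiv.Perm n, ‖Equiv.Perm.sign σ • ∏ i, A.transpose (σ i) i‖ := norm_sum_le _ _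
    _ ≤ ∑ σ : Equiv.Perm n, ∏ i, B i := by
        refine Finset.sum_le_sum fun σ _ ↦ ?_
        have : ‖Equiv.Perm.sign σ • ∏ i, A.transpose (σ i) i‖ = ∏ i, ‖A i (σ i)‖ := by
          rcases Int.units_eq_one_or (Equiv.Perm.sign σ) with h | h <;> simp [h]
        rw [this]
        exact Finset.prod_le_prod (fun _ _ ↦ norm_nonneg _) fun i _ ↦ hA i _
    _ = _ := by simp [Fintype.card_perm]

/-- Hadamard-type bound for the discriminant of `K` in terms of an integral `ℚ`-basis. -/
theorem abs_discr_le_of_basis {K : Type*} [Field K] [NumberField K] {ι : Type*} [Fintype ι]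
    (b : Module.Basis ι ℚ K) (hb : ∀ i, IsIntegral ℤ (b i)) (B : ι → ℝ)
    (hB : ∀ i, ∀ φ : K →+* ℂ, ‖φ (b i)‖ ≤ B i) :
    ((|discr K| : ℤ) : ℝ) ≤ ((Fintype.card ι).factorial * ∏ i, B i) ^ 2 := by
  classical
  let c := (integralBasis K).reindex ((integralBasis K).indexEquiv b)
  -- The determinant is, up to sign, the index in `𝓞 K` of the lattice spanned by `b`: a nonzero
  -- integer, so |Δ_K| is at most the discriminant of `b`.
  have hdisc : Algebra.discr ℚ b = (c.toMatrix b).det ^ 2 * discr K := by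
    conv_lhs => rw [← c.toMatrix_map_vecMul b]
    rw [Algebra.discr_of_matrix_vecMul, coe_discr, Module.Basis.coe_reindex, Algebra.discr_reindex]
  have hint : IsIntegral ℤ (c.toMatrix b).det := by
    refine IsIntegral.det fun i j ↦ ?_
    have h1 := integralBasis_repr_apply (K := K) ⟨b j, hb j⟩
      (((integralBasis K).indexEquiv b).symm i)
    rw [Module.Basis.toMatrix_apply, Module.Basis.repr_reindex_apply]
    erw [h1]
    exact isIntegral_algebraMap
  obtain ⟨n, hn⟩ := IsIntegrallyClosed.isIntegral_iff.mp hint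
  have h0 : n ≠ 0 := by
    rintro rfl
    apply Algebra.discr_not_zero_of_basis ℚ b
    rw [hdisc, ← hn]; simp
  have hcard : Fintype.card ι = Fintype.card (K →ₐ[ℚ] ℂ) := by
    rw [AlgHom.card, Module.finrank_eq_card_basis b]
  let e : ι ≃ (K →ₐ[ℚ] ℂ) := Fintype.equivOfCardEq hcard
  have hdet := Algebra.discr_eq_det_embeddingsMatrixReindex_pow_two ℚ ℂ b e
  rw [hdisc, ← hn] at hdet
  have hdet' : ((n ^ 2 * discr K : ℤ) : ℂ) = (Algebra.embeddingsMatrixReindex ℚ ℂ b e).det ^ 2 := by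
    rw [← hdet]; push_cast; simp
  have h1 : ‖((n ^ 2 * discr K : ℤ) : ℂ)‖ ≤ ((Fintype.card ι).factorial * ∏ i, B i) ^ 2 := by
    rw [hdet', norm_pow]
    gcongr
    exact abs_det_le_factorial_mul_prod _ _ fun i j ↦ hB i (e j).toRingHom
  refine le_trans ?_ h1
  rw [Complex.norm_intCast, ← Int.cast_abs, Int.cast_le, abs_mul, abs_pow]
  have := Int.one_le_abs h0
  nlinarith [abs_nonneg (discr K), pow_le_pow_left₀ zero_le_one this 2]

/-- Hermite's theorem for intermediate fields of `Ω / k`. -/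
theorem finite_setOf_abs_discr_le (k : Type*) [Field k] [NumberField k] (Ω : Type*)
    [Field Ω] [Algebra k Ω] (T : ℝ) :
    {K : IntermediateField k Ω | ∃ _ : NumberField K, ((|discr K| : ℤ) : ℝ) ≤ T}.Finite := by
  have : CharZero Ω := charZero_of_injective_algebraMap (algebraMap k Ω).injective
  have hfin := NumberField.finite_of_discr_bdd Ω ⌊T⌋₊
  refine Set.Finite.of_finite_image (f := fun K : IntermediateField k Ω ↦ K.restrictScalars ℚ)
    ((hfin.image Subtype.val).subset ?_) (IntermediateField.restrictScalars_injective ℚ).injOn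
  rintro _ ⟨K, ⟨hK, hT⟩, rfl⟩
  refine ⟨⟨K.restrictScalars ℚ, hK.to_finiteDimensional⟩, ?_, rfl⟩
  have h0 : (0 : ℝ) ≤ ((|discr K| : ℤ) : ℝ) := by positivity
  have : |discr K| ≤ (⌊T⌋₊ : ℤ) := by
    rw [Int.natCast_floor_eq_floor (h0.trans hT)]
    exact Int.le_floor.mpr hT
  exact this

/-! ### Eisenstein polynomials -/

theorem exists_prime_mem_notMem_sq (R : Type*) [CommRing R] [IsDedekindDomain R] (h : ¬ IsField R) :
    ∃ (P : Ideal R) (π : R), P.IsPrime ∧ π ∈ P ∧ π ∉ P ^ 2 := by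
  obtain ⟨P, hP0, hP⟩ := Ring.not_isField_iff_exists_prime.mp h
  obtain ⟨π, h1, h2⟩ := Ideal.exists_mem_pow_notMem_pow_succ P hP0 hP.ne_top 1
  exact ⟨P, π, hP, by simpa using h1, h2⟩

/-- The monic polynomial of degree `e` with lower coefficients `a`. -/
noncomputable def monicOfCoeffs {R : Type*} [CommRing R] {e : ℕ} (a : Fin e → R) : R[X] :=
  X ^ e + ∑ j : Fin e, C (a j) * X ^ (j : ℕ)

section monicOfCoeffs

variable {R : Type*} [CommRing R] {e : ℕ} (a : Fin e → R)

theorem monicOfCoeffs_monic : (monicOfCoeffs a).Monic :=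
  monic_X_pow_add (degree_sum_fin_lt _)

theorem natDegree_monicOfCoeffs [Nontrivial R] : (monicOfCoeffs a).natDegree = e := by
  refine natDegree_eq_of_degree_eq_some ?_
  rw [monicOfCoeffs, degree_add_eq_left_of_degree_lt] <;> rw [degree_X_pow]
  exact degree_sum_fin_lt _

theorem coeff_monicOfCoeffs (j : Fin e) : (monicOfCoeffs a).coeff j = a j := by
  simp [monicOfCoeffs, coeff_X_pow, j.2.ne, coeff_C_mul, Fin.val_inj]

theorem monicOfCoeffs_injective : Function.Injective (monicOfCoeffs (R := R) (e := e)) := by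
  intro a b h
  ext j
  rw [← coeff_monicOfCoeffs a, h, coeff_monicOfCoeffs]

theorem aeval_monicOfCoeffs {A : Type*} [CommRing A] [Algebra R A] (x : A) :
    aeval x (monicOfCoeffs a) = x ^ e + ∑ j : Fin e, algebraMap R A (a j) * x ^ (j : ℕ) := by
  simp [monicOfCoeffs]

/-- Coefficients of an Eisenstein polynomial, affine in the parameters `c`. -/
def eisensteinCoeffs (π : R) (c : Fin e → R) (j : Fin e) : R :=
  π * ((if (j : ℕ) = 0 then 1 else 0) + π * c j)

theorem eisensteinCoeffs_injective [IsDomain R] {π : R} (hπ : π ≠ 0) :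
    Function.Injective (eisensteinCoeffs (e := e) π) := by
  intro c d h
  ext j
  simpa [eisensteinCoeffs, hπ] using congrFun h j

/-- The constant term is congruent to π modulo P², so the Eisenstein condition holds for every
choice of `c`. -/
theorem irreducible_monicOfCoeffs_eisensteinCoeffs [IsDomain R] (he : 0 < e) {P : Ideal R}
    (hP : P.IsPrime) {π : R} (h1 : π ∈ P) (h2 : π ∉ P ^ 2) (c : Fin e → R) :
    Irreducible (monicOfCoeffs (eisensteinCoeffs π c)) := by
  have hm := monicOfCoeffs_monic (eisensteinCoeffs π c)
  have hd := natDegree_monicOfCoeffs (eisensteinCoeffs π c)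
  refine IsEisensteinAt.irreducible (𝓟 := P) ⟨?_, ?_, ?_⟩ hP hm.isPrimitive (by rwa [hd])
  · rw [hm.leadingCoeff]
    exact fun h ↦ hP.ne_top ((Ideal.eq_top_iff_one _).mpr h)
  · intro n hn
    rw [hd] at hn
    rw [coeff_monicOfCoeffs _ ⟨n, hn⟩]
    exact P.mul_mem_right _ h1
  · rw [coeff_monicOfCoeffs _ ⟨0, he⟩]
    intro h
    apply h2
    have h3 : π * (π * c ⟨0, he⟩) ∈ P ^ 2 := by
      rw [← mul_assoc, ← sq]
      exact Ideal.mul_mem_right _ _ (Ideal.pow_mem_pow h1 2)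
    have : π = eisensteinCoeffs π c ⟨0, he⟩ - π * (π * c ⟨0, he⟩) := by
      simp [eisensteinCoeffs]; ring
    rw [this]
    exact Ideal.sub_mem _ h h3

end monicOfCoeffs

/-! ### Fields generated by a root -/

theorem abs_discr_le_of_powerBasis {k K : Type*} [Field k] [NumberField k] [Field K] [NumberField K]
    [Algebra k K] (pb : PowerBasis k K) (hint : IsIntegral ℤ pb.gen) {e : ℕ} (he : pb.dim = e)
    {W X : ℝ} (hW : ∀ φ : k →+* ℂ, ∀ i, ‖φ (integralBasis k i)‖ ≤ W)
    (hX : ∀ φ : K →+* ℂ, ‖φ pb.gen‖ ≤ X) :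
    ((|discr K| : ℤ) : ℝ) ≤ ((Module.finrank ℚ k * e).factorial *
      ∏ p : Module.Free.ChooseBasisIndex ℤ (𝓞 k) × Fin e, (W * X ^ (p.2 : ℕ))) ^ 2 := by
  subst he
  have h := abs_discr_le_of_basis ((integralBasis k).smulTower pb.basis) (fun p ↦ ?_)
    (fun p ↦ W * X ^ (p.2 : ℕ)) (fun p φ ↦ ?_)
  · rwa [Fintype.card_prod, Fintype.card_fin, ← Module.finrank_eq_card_basis (integralBasis k)] at h
  · rw [Module.Basis.smulTower_apply, pb.basis_eq_pow, integralBasis_apply, Algebra.smul_def]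
    exact ((RingOfIntegers.isIntegral_coe _).algebraMap).mul (hint.pow _)
  · rw [Module.Basis.smulTower_apply, pb.basis_eq_pow, Algebra.smul_def, map_mul, norm_mul,
      map_pow, norm_pow]
    have := hW (φ.comp (algebraMap k K)) p.1
    exact mul_le_mul this (pow_le_pow_left₀ (norm_nonneg _) (hX φ) _) (by positivity)
      ((norm_nonneg _).trans this)

section root

variable {k : Type*} [Field k] [NumberField k]

theorem minpoly_eq_map_of_irreducible {Ω : Type*} [Field Ω] [Algebra k Ω] {f : (𝓞 k)[X]}
    (hf : f.Monic) (hi : Irreducible f) {α : Ω} (h : aeval α f = 0) :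
    minpoly k α = f.map (algebraMap (𝓞 k) k) := by
  refine (minpoly.eq_of_irreducible_of_monic (hf.irreducible_iff_irreducible_map_fraction_map.mp hi)
    ?_ (hf.map _)).symm
  rwa [aeval_map_algebraMap]

omit [NumberField k] in
theorem norm_embedding_le_of_root {K : Type*} [Field K] [Algebra k K] {e : ℕ} {X : ℝ} (hX : 0 ≤ X)
    {a : Fin e → 𝓞 k} (ha : ∀ φ : k →+* ℂ, ∀ j, ‖φ (a j)‖ ≤ X ^ (e - j : ℕ)) {α : K}
    (h : aeval α (monicOfCoeffs a) = 0) (φ : K →+* ℂ) : ‖φ α‖ ≤ 2 * X := by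
  refine norm_le_two_mul_of_root hX (fun j ↦ φ (algebraMap (𝓞 k) K (a j))) _
    (fun j ↦ ha (φ.comp (algebraMap k K)) j) ?_
  have := congrArg φ h
  rw [aeval_monicOfCoeffs] at this
  simpa using this

omit [NumberField k] in
theorem isIntegral_int_of_root {K : Type*} [Field K] [Algebra k K] {f : (𝓞 k)[X]} (hf : f.Monic)
    {α : K} (h : aeval α f = 0) : IsIntegral ℤ α :=
  isIntegral_trans (A := 𝓞 k) α ⟨f, hf, h⟩

end root

/-- Reversing j turns e - j into j + 1. The surplus `card ι * e` is the exponent later absorbed by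
the multiplicity of each field. -/
theorem sum_sub_val_eq (ι : Type*) [Fintype ι] (e : ℕ) :
    ∑ p : ι × Fin e, (e - (p.2 : ℕ)) = ∑ p : ι × Fin e, (p.2 : ℕ) + Fintype.card ι * e := by
  have h : ∑ j : Fin e, (e - (j : ℕ)) = ∑ j : Fin e, ((j : ℕ) + 1) := by
    rw [← Equiv.sum_comp Fin.revPerm]
    refine Finset.sum_congr rfl fun j _ ↦ ?_
    simp only [Fin.revPerm_apply, Fin.val_rev]
    have := j.2
    omega
  simp only [Fintype.sum_prod_type, h, Finset.sum_add_distrib]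
  simp

/-! ### The family of polynomials and its coefficient bounds -/

section family

variable {k : Type*} [Field k] [NumberField k] {e : ℕ}

/-- The Eisenstein polynomial over `𝓞 k` whose coefficients have integer coordinates `n`. -/
noncomputable def eisensteinFamily (π : 𝓞 k)
    (n : Module.Free.ChooseBasisIndex ℤ (𝓞 k) × Fin e → ℕ) : (𝓞 k)[X] :=
  monicOfCoeffs (eisensteinCoeffs π fun j ↦ ∑ i, (n (i, j) : ℤ) • RingOfIntegers.basis k i)

theorem eisensteinFamily_injective {π : 𝓞 k} (hπ : π ≠ 0) :
    Function.Injective (eisensteinFamily (e := e) π) := by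
  intro n n' h
  have h1 := eisensteinCoeffs_injective hπ (monicOfCoeffs_injective h)
  funext ⟨i, j⟩
  have h2 := congrArg (fun x ↦ (RingOfIntegers.basis k).repr x i) (congrFun h1 j)
  rw [Module.Basis.repr_sum_self, Module.Basis.repr_sum_self] at h2
  exact_mod_cast h2

theorem exists_nat_bound (π : 𝓞 k) : ∃ A : ℕ, 1 ≤ A ∧
    (∀ φ : k →+* ℂ, ∀ i, ‖φ (integralBasis k i)‖ ≤ A) ∧
    ∀ φ : k →+* ℂ, ‖φ π‖ * (1 + ‖φ π‖ * ∑ i, ‖φ (integralBasis k i)‖) ≤ A := by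
  obtain ⟨M, hM⟩ := Finite.exists_le
    (fun p : (k →+* ℂ) × Module.Free.ChooseBasisIndex ℤ (𝓞 k) ↦ ‖p.1 (integralBasis k p.2)‖)
  obtain ⟨M', hM'⟩ := Finite.exists_le
    (fun φ : k →+* ℂ ↦ ‖φ π‖ * (1 + ‖φ π‖ * ∑ i, ‖φ (integralBasis k i)‖))
  obtain ⟨A, hA⟩ := exists_nat_ge (max M M')
  refine ⟨A + 1, by omega, fun φ i ↦ (hM (φ, i)).trans ?_, fun φ ↦ (hM' φ).trans ?_⟩
  · push_cast; linarith [le_max_left M M']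
  · push_cast; linarith [le_max_right M M']

theorem norm_eisensteinCoeffs_le {π : 𝓞 k} {A N : ℕ} (hA : 1 ≤ A) (hN : 1 ≤ N)
    (hπ : ∀ φ : k →+* ℂ, ‖φ π‖ * (1 + ‖φ π‖ * ∑ i, ‖φ (integralBasis k i)‖) ≤ A)
    {n : Module.Free.ChooseBasisIndex ℤ (𝓞 k) × Fin e → ℕ}
    (hn : ∀ p, n p < N ^ (e - p.2 : ℕ)) (φ : k →+* ℂ) (j : Fin e) :
    ‖φ (algebraMap (𝓞 k) k
      (eisensteinCoeffs π (fun j ↦ ∑ i, (n (i, j) : ℤ) • RingOfIntegers.basis k i) j))‖ ≤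
      ((A * N : ℕ) : ℝ) ^ (e - j : ℕ) := by
  have hN1 : (1 : ℝ) ≤ (N : ℝ) ^ (e - j : ℕ) := one_le_pow₀ (by exact_mod_cast hN)
  -- Since j < e, the exponent is at least 1, so the constant A fits inside (A * N)^(e-j).
  have hA1 : (A : ℝ) ≤ (A : ℝ) ^ (e - j : ℕ) :=
    le_self_pow₀ (by exact_mod_cast hA) (by have := j.2; omega)
  have hsum : ‖φ (algebraMap (𝓞 k) k (∑ i, (n (i, j) : ℤ) • RingOfIntegers.basis k i))‖ ≤
      N ^ (e - j : ℕ) * ∑ i, ‖φ (integralBasis k i)‖ := by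
    rw [map_sum, map_sum, Finset.mul_sum]
    refine (norm_sum_le _ _).trans (Finset.sum_le_sum fun i _ ↦ ?_)
    rw [map_zsmul, map_zsmul, integralBasis_apply, zsmul_eq_mul, norm_mul]
    gcongr
    simp only [Int.cast_natCast, Complex.norm_natCast]
    exact_mod_cast (hn (i, j)).le
  have hdelta : ‖φ (algebraMap (𝓞 k) k (if (j : ℕ) = 0 then 1 else 0))‖ ≤ (N : ℝ) ^ (e - j : ℕ) := by
    split_ifs
    · simpa using hN1
    · simp
  calc _ = ‖φ π‖ * ‖φ (algebraMap (𝓞 k) k (if (j : ℕ) = 0 then 1 else 0)) +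
        φ π * φ (algebraMap (𝓞 k) k (∑ i, (n (i, j) : ℤ) • RingOfIntegers.basis k i))‖ := by
        rw [eisensteinCoeffs, map_mul, map_add, map_mul, map_mul, map_add, map_mul, norm_mul]
    _ ≤ ‖φ π‖ * ((N : ℝ) ^ (e - j : ℕ) +
        ‖φ π‖ * (N ^ (e - j : ℕ) * ∑ i, ‖φ (integralBasis k i)‖)) := by
        refine mul_le_mul_of_nonneg_left ((norm_add_le _ _).trans ?_) (norm_nonneg _)
        rw [norm_mul]
        gcongr
    _ = N ^ (e - j : ℕ) * (‖φ π‖ * (1 + ‖φ π‖ * ∑ i, ‖φ (integralBasis k i)‖)) := by ring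
    _ ≤ N ^ (e - j : ℕ) * A ^ (e - j : ℕ) := by
        gcongr
        exact (hπ φ).trans hA1
    _ = _ := by push_cast; ring

end family

/-! ### Counting the fields -/

/-- There are `≫ N ^ E` extensions of degree `e` with discriminant `≪ N ^ (2 * E)`. -/
theorem pow_le_mul_discrCount (k : Type*) [Field k] [NumberField k] (e : ℕ) (he : 1 < e) :
    ∃ E : ℕ, E ≠ 0 ∧ ∃ C₁ : ℝ, 0 < C₁ ∧ ∃ C₂ : ℝ, 0 < C₂ ∧
      ∀ (Ω : Type*) [Field Ω] [Algebra k Ω] [IsAlgClosure k Ω], ∀ N : ℕ, 1 ≤ N → ∀ T : ℝ,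
        C₁ * ((N : ℝ) ^ E) ^ 2 ≤ T →
          (N : ℝ) ^ E ≤ C₂ * (discrCount k Ω e T : ℝ) := by
  classical
  obtain ⟨P, π, hP, hπ1, hπ2⟩ := exists_prime_mem_notMem_sq (𝓞 k) (RingOfIntegers.not_isField k)
  have hπ0 : π ≠ 0 := by rintro rfl; exact hπ2 (zero_mem _)
  obtain ⟨A, hA, hbasis, hAπ⟩ := exists_nat_bound π
  let ι := Module.Free.ChooseBasisIndex ℤ (𝓞 k)
  let E : ℕ := ∑ p : ι × Fin e, (p.2 : ℕ)
  let m := Module.finrank ℚ k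
  have hm : Fintype.card ι = m := (Module.finrank_eq_card_basis (integralBasis k)).symm
  have hE : E ≠ 0 := by
    intro h
    have hne : Nonempty ι := (integralBasis k).index_nonempty
    have := Finset.sum_eq_zero_iff.mp h (Classical.arbitrary ι, ⟨1, he⟩) (Finset.mem_univ _)
    simp at this
  -- The discriminant bound before squaring, at N = 1; for general N it gains the factor N^E.
  let D : ℝ := (m * e).factorial * ∏ p : ι × Fin e, ((A : ℝ) * (2 * A) ^ (p.2 : ℕ))
  have hA0 : (0 : ℝ) < A := by exact_mod_cast hA
  -- Conjugates are at most X = 2AN, and 8X + 2 ≤ 18AN.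
  refine ⟨E, hE, D ^ 2, by positivity, (18 * A : ℝ) ^ (m * e), by positivity, ?_⟩
  intro Ω _ _ _ N hN T hT
  have hN0 : (0 : ℝ) < N := by exact_mod_cast hN
  have : IsAlgClosed Ω := IsAlgClosure.isAlgClosed k
  have hchar : CharZero Ω := charZero_of_injective_algebraMap (algebraMap k Ω).injective
  let f : (ι × Fin e → ℕ) → (𝓞 k)[X] := eisensteinFamily π
  have hfm : ∀ n, (f n).Monic := fun n ↦ monicOfCoeffs_monic _
  have hfd : ∀ n, (f n).natDegree = e := fun n ↦ natDegree_monicOfCoeffs _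
  have hfi : ∀ n, Irreducible (f n) := fun n ↦
    irreducible_monicOfCoeffs_eisensteinCoeffs (by omega) hP hπ1 hπ2 _
  have hroot : ∀ n, ∃ α : Ω, aeval α (f n) = 0 := by
    intro n
    obtain ⟨α, hα⟩ := IsAlgClosed.exists_aeval_eq_zero Ω ((f n).map (algebraMap (𝓞 k) k)) (by
      rw [(hfm n).degree_map, degree_eq_natDegree (hfm n).ne_zero, hfd]
      exact_mod_cast (by omega : e ≠ 0))
    exact ⟨α, by rwa [aeval_map_algebraMap] at hα⟩
  choose α hα using hroot
  have hmin : ∀ n, minpoly k (α n) = (f n).map (algebraMap (𝓞 k) k) := fun n ↦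
    minpoly_eq_map_of_irreducible (hfm n) (hfi n) (hα n)
  have hαinj : Function.Injective α := by
    intro n n' h
    have h1 := (hmin n).symm.trans ((congrArg (minpoly k) h).trans (hmin n'))
    exact eisensteinFamily_injective hπ0
      (map_injective _ (FaithfulSMul.algebraMap_injective (𝓞 k) k) h1)
  have hint : ∀ n, IsIntegral k (α n) := fun n ↦
    ⟨(f n).map (algebraMap (𝓞 k) k), (hfm n).map _, by
      rw [← aeval_def, aeval_map_algebraMap, hα]⟩
  let S : Finset (ι × Fin e → ℕ) := Fintype.piFinset fun p ↦ Finset.range (N ^ (e - p.2 : ℕ))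
  have hS : S.card = N ^ (E + m * e) := by
    simp only [S, Fintype.card_piFinset, Finset.card_range, Finset.prod_pow_eq_pow_sum]
    rw [sum_sub_val_eq, hm]
  have hdeg : ∀ n, Module.finrank k k⟮α n⟯ = e := fun n ↦ by
    rw [adjoin.finrank (hint n), hmin, (hfm n).natDegree_map, hfd]
  have htower : ∀ K : IntermediateField k Ω, IsScalarTower (𝓞 k) K Ω := fun K ↦
    IsScalarTower.of_algebraMap_eq fun _ ↦ rfl
  have hsub : ∀ n (K : IntermediateField k Ω) (h : α n ∈ K),
      aeval (⟨α n, h⟩ : K) (f n) = 0 := by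
    intro n K h
    apply Subtype.val_injective
    have := aeval_algebraMap_apply Ω (⟨α n, h⟩ : K) (f n)
    exact this.symm.trans (hα n)
  have hbound : ∀ n ∈ S, ∀ (K : IntermediateField k Ω) (h : α n ∈ K) (φ : K →+* ℂ),
      ‖φ ⟨α n, h⟩‖ ≤ 2 * (A * N : ℕ) := by
    intro n hn K h φ
    refine norm_embedding_le_of_root (Nat.cast_nonneg _)
      (norm_eisensteinCoeffs_le hA hN hAπ fun p ↦ ?_) (hsub n K h) φ
    simpa using Fintype.mem_piFinset.mp hn p
  have hfield : ∀ n ∈ S, k⟮α n⟯ ∈ extensionsOfDegreeDiscrLE k Ω e T := by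
    intro n hn
    have hNF : NumberField k⟮α n⟯ := numberField_of_mem (by omega) (hdeg n)
    refine ⟨hdeg n, hNF, le_trans ?_ hT⟩
    have hgen : (adjoin.powerBasis (hint n)).gen =
        ⟨α n, mem_adjoin_simple_self k (α n)⟩ := adjoin.powerBasis_gen (hint n)
    refine (abs_discr_le_of_powerBasis (adjoin.powerBasis (hint n)) ?_ (e := e) ?_ hbasis
      (X := 2 * (A * N : ℕ)) ?_).trans (le_of_eq ?_)
    · rw [hgen]
      exact isIntegral_int_of_root (hfm n) (hsub n _ _)
    · rw [← PowerBasis.finrank, hdeg]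
    · rw [hgen]
      exact hbound n hn _ _
    · rw [← mul_pow]
      congr 1
      simp only [D, E, m, ι, mul_assoc]
      congr 1
      rw [← Finset.prod_pow_eq_pow_sum, ← Finset.prod_mul_distrib]
      refine Finset.prod_congr rfl fun p _ ↦ ?_
      push_cast
      ring
  have hfin : (extensionsOfDegreeDiscrLE k Ω e T).Finite :=
    (finite_setOf_abs_discr_le k Ω T).subset fun K hK ↦ hK.2
  have himage : (S.image fun n ↦ k⟮α n⟯).card ≤ discrCount k Ω e T := by
    rw [discrCount, ← Set.ncard_coe_finset]
    refine Set.ncard_le_ncard (fun K hK ↦ ?_) hfin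
    obtain ⟨n, hn, rfl⟩ := Finset.mem_image.mp hK
    exact hfield n hn
  have hfiber : ∀ K ∈ S.image (fun n ↦ k⟮α n⟯),
      (S.filter fun n ↦ k⟮α n⟯ = K).card ≤ (18 * A * N) ^ (m * e) := by
    intro K hK
    obtain ⟨n₀, hn₀, hK⟩ := Finset.mem_image.mp hK
    have hKdeg : Module.finrank k K = e := hK ▸ hdeg n₀
    have hNF : NumberField K := numberField_of_mem (by omega) hKdeg
    have hmem : ∀ n, k⟮α n⟯ = K → α n ∈ K := fun n h ↦ h ▸ mem_adjoin_simple_self k (α n)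
    -- The value 0 is never used on the fiber, where α n lies in K.
    let g : (ι × Fin e → ℕ) → K := fun n ↦ if h : α n ∈ K then ⟨α n, h⟩ else 0
    have hg : ∀ n (h : α n ∈ K), g n = ⟨α n, h⟩ := fun n h ↦ dif_pos h
    have hginj : Set.InjOn g (S.filter fun n ↦ k⟮α n⟯ = K) := by
      intro n hn n' hn' h
      rw [hg n (hmem n (Finset.mem_filter.mp hn).2),
        hg n' (hmem n' (Finset.mem_filter.mp hn').2)] at h
      exact hαinj (congrArg Subtype.val h)
    rw [← Finset.card_image_of_injOn hginj]
    have := card_le_of_forall_norm_embedding_le (2 * (A * N : ℕ) : ℝ)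
      ((S.filter fun n ↦ k⟮α n⟯ = K).image g) ?_ ?_ (18 * A * N) ?_
    · rwa [← Module.finrank_mul_finrank ℚ k K, hKdeg] at this
    · intro x hx
      obtain ⟨n, hn, rfl⟩ := Finset.mem_image.mp hx
      rw [hg n (hmem n (Finset.mem_filter.mp hn).2)]
      exact isIntegral_int_of_root (hfm n) (hsub n _ _)
    · intro x hx φ
      obtain ⟨n, hn, rfl⟩ := Finset.mem_image.mp hx
      rw [hg n (hmem n (Finset.mem_filter.mp hn).2)]
      exact hbound n (Finset.mem_filter.mp hn).1 _ _ φ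
    · have : (1 : ℝ) ≤ A * N := by exact_mod_cast Nat.mul_pos hA hN
      push_cast
      linarith
  have hcard := Finset.card_le_mul_card_image S _ hfiber
  rw [hS, pow_add] at hcard
  have hcard' : (N : ℝ) ^ E * (N : ℝ) ^ (m * e) ≤
      (18 * A * N : ℝ) ^ (m * e) * (discrCount k Ω e T : ℝ) := by
    exact_mod_cast hcard.trans (Nat.mul_le_mul_left _ himage)
  rw [mul_pow _ (N : ℝ), mul_right_comm] at hcard'
  exact le_of_mul_le_mul_right hcard' (by positivity)

end NumberFieldCount

/-! ### Passage from N to real T -/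

theorem corollary5p2 (k : Type*) [Field k] [NumberField k] (e : ℕ) (he : 1 < e) :
    ∃ c : ℝ, 0 < c ∧ ∃ T₁ : ℝ, 0 < T₁ ∧
      ∀ (Ω : Type*) [Field Ω] [Algebra k Ω] [IsAlgClosure k Ω],
        ∀ T : ℝ, T₁ ≤ T →
          c * T ^ (1 / 2 : ℝ) ≤ (NumberFieldCount.discrCount k Ω e T : ℝ) := by
  obtain ⟨E, hE, C₁, hC₁, C₂, hC₂, h⟩ := NumberFieldCount.pow_le_mul_discrCount k e he
  refine ⟨(C₂ * (2 ^ E * √C₁))⁻¹, by positivity, C₁, hC₁, fun Ω _ _ _ T hT ↦ ?_⟩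
  -- T is squeezed between consecutive values of C₁ N^(2E); N + 1 ≤ 2N then costs the factor 2^E in
  -- the constant.
  obtain ⟨N, hN, hN1, hN2⟩ : ∃ N : ℕ, 1 ≤ N ∧ C₁ * ((N : ℝ) ^ E) ^ 2 ≤ T ∧
      T ≤ C₁ * (((N + 1 : ℕ) : ℝ) ^ E) ^ 2 := by
    classical
    have hex : ∃ N : ℕ, T ≤ C₁ * (((N + 1 : ℕ) : ℝ) ^ E) ^ 2 := by
      obtain ⟨N, hN⟩ := exists_nat_ge (T / C₁)
      refine ⟨N, ?_⟩
      rw [div_le_iff₀' hC₁] at hN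
      refine hN.trans (mul_le_mul_of_nonneg_left ?_ hC₁.le)
      rw [← pow_mul]
      refine le_trans ?_ (le_self_pow₀ (by simp) (by simpa using hE))
      simp
    -- The search returns 0 only when T = C₁, and then N = 1 serves.
    rcases Nat.eq_zero_or_pos (Nat.find hex) with h0 | h0
    · refine ⟨1, le_rfl, by simpa using hT, ?_⟩
      have := Nat.find_spec hex
      rw [h0] at this
      simp only [zero_add, Nat.cast_one, one_pow, mul_one] at this
      refine this.trans (le_mul_of_one_le_right hC₁.le ?_)
      rw [← pow_mul]
      exact one_le_pow₀ (by norm_num)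
    · have := Nat.find_min hex (Nat.sub_lt h0 one_pos)
      rw [not_le, Nat.sub_add_cancel (m := 1) h0] at this
      exact ⟨_, h0, this.le, Nat.find_spec hex⟩
  have hN0 : (1 : ℝ) ≤ N := by exact_mod_cast hN
  have hsqrt : √T ≤ √C₁ * (2 ^ E * (N : ℝ) ^ E) := by
    refine (Real.sqrt_le_sqrt hN2).trans ?_
    rw [Real.sqrt_mul hC₁.le, Real.sqrt_sq (by positivity), ← mul_pow]
    gcongr
    push_cast
    linarith
  rw [← Real.sqrt_eq_rpow, inv_mul_le_iff₀ (by positivity)]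
  calc √T ≤ √C₁ * (2 ^ E * (N : ℝ) ^ E) := hsqrt
    _ ≤ √C₁ * (2 ^ E * (C₂ * (NumberFieldCount.discrCount k Ω e T : ℝ))) := by
        gcongr
        exact h Ω N hN T hN1
    _ = _ := by ring
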